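/- Let $d \ge 1$ be an integer, let $p \in [1,\infty)$, and let $(\rho_n)_{n\in\mathbb{N}}$ be a sequence of radial mollifiers, i.e. for every $n$, $\rho_n \in L^1_{\mathrm{loc}}(0,\infty)$, $\rho_n \ge 0$, $\int_0^\infty \rho_n(r)\, r^{d-1}\,dr = 1$ and $\rho_n(r) = 0$ for $r > 1$, and $$\lim_{n\to\infty} \int_\delta^\infty \rho_n(r)\, r^{d-1}\,dr = 0 \quad \text{for every } \delta > 0.$$ Let $u \in W^{1,p}_{\mathrm{loc}}(\mathbb{R}^d)$ be real-valued, with weak gradient $\nabla u$. Then $$\lim_{n\to\infty} \int_{\mathbb{R}^d} \frac{|u(x+h)-u(x)-\nabla u(x)\cdot h|^p}{|h|^p}\,\rho_n(|h|)\,dh = 0 \quad \text{for a.e. } x \in \mathbb{R}^d.$$ Consequently, setting $$D_{n,p}(u)(x) := \int_{\mathbb{R}^d} \frac{|u(x)-u(y)|^p}{|x-y|^p}\,\rho_n(|x-y|)\,dy \in [0,\infty], \qquad \gamma_{d,p} := \int_{\mathbb{S}^{d-1}} |\sigma\cdot e|^p\,d\sigma,$$ where $e$ is any unit vector of $\mathbb{R}^d$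 (the value does not depend on $e$) and $d\sigma$ is the surface measure on the unit sphere $\mathbb{S}^{d-1}$ (the counting measure on $\{-1,1\}$ if $d=1$), one has $$\lim_{n\to\infty} D_{n,p}(u)(x) = \gamma_{d,p}\,|\nabla u(x)|^p \quad \text{for a.e. } x \in \mathbb{R}^d.$$ -/

import Mathlib

open MeasureTheory Filter Topology Set
open scoped ENNReal ContDiff

/-- A sequence `ρ` of radial mollifiers in dimension `d`. Only the values `ρ n r` with `r > 0`
are relevant, and these only up to Lebesgue-null sets of radii. -/
structure IsRadialMollifier (d : ℕ) (ρ : ℕ → ℝ → ℝ) : Prop where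
  locallyIntegrable : ∀ n, LocallyIntegrableOn (ρ n) (Ioi 0) volume
  nonneg : ∀ n, ∀ᵐ r : ℝ, 0 < r → 0 ≤ ρ n r
  integral_eq_one : ∀ n, ∫ r in Ioi (0 : ℝ), ρ n r * r ^ (d - 1) = 1
  tendsto_tail : ∀ δ : ℝ, 0 < δ →
    Tendsto (fun n => ∫ r in Ioi δ, ρ n r * r ^ (d - 1)) atTop (𝓝 0)
  eq_zero_of_one_lt : ∀ n, ∀ᵐ r : ℝ, 1 < r → ρ n r = 0

/-- The space `L^p_loc(ℝ^d; F)`, for a real exponent `p`. -/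
def MemLpLoc {d : ℕ} {F : Type*} [NormedAddCommGroup F] (p : ℝ)
    (f : EuclideanSpace ℝ (Fin d) → F) : Prop :=
  ∀ K : Set (EuclideanSpace ℝ (Fin d)), IsCompact K →
    MemLp f (ENNReal.ofReal p) (volume.restrict K)

/-- `G` is (a representative of) the weak gradient of `u` on `ℝ^d`. -/
structure HasWeakGradient {d : ℕ} (u : EuclideanSpace ℝ (Fin d) → ℝ)
    (G : EuclideanSpace ℝ (Fin d) → EuclideanSpace ℝ (Fin d)) : Prop where
  locallyIntegrable : LocallyIntegrable u volume
  locallyIntegrable_grad : LocallyIntegrable G volume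
  integral_eq : ∀ φ : EuclideanSpace ℝ (Fin d) → ℝ, ContDiff ℝ ∞ φ → HasCompactSupport φ →
    ∀ i : Fin d,
      ∫ x, u x * fderiv ℝ φ x (EuclideanSpace.single i 1) = - ∫ x, G x i * φ x

/-- The Sobolev space `W^{1,p}_loc(ℝ^d)`. -/
def MemSobolevLoc {d : ℕ} (p : ℝ) (u : EuclideanSpace ℝ (Fin d) → ℝ) : Prop :=
  MemLpLoc p u ∧
    ∃ G : EuclideanSpace ℝ (Fin d) → EuclideanSpace ℝ (Fin d),
      HasWeakGradient u G ∧ MemLpLoc p G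

/-- The function `D_{n,p}(u)` built from one mollifier `ρ = ρ_n`, with values in `[0, ∞]`. -/
noncomputable def nonlocalD {d : ℕ} (ρ : ℝ → ℝ) (p : ℝ) (u : EuclideanSpace ℝ (Fin d) → ℝ)
    (x : EuclideanSpace ℝ (Fin d)) : ℝ≥0∞ :=
  ∫⁻ y, ENNReal.ofReal (|u x - u y| ^ p / ‖x - y‖ ^ p * ρ ‖x - y‖)

/-- The `p`-th power of the first order Taylor remainder of `u` at `x`, where `V` plays the role
of the gradient of `u` at `x`, averaged against one mollifier `ρ`; values in `[0, ∞]`. -/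
noncomputable def taylorRemainder {d : ℕ} (ρ : ℝ → ℝ) (p : ℝ)
    (u : EuclideanSpace ℝ (Fin d) → ℝ) (V x : EuclideanSpace ℝ (Fin d)) : ℝ≥0∞ :=
  ∫⁻ h, ENNReal.ofReal (|u (x + h) - u x - inner ℝ V h| ^ p / ‖h‖ ^ p * ρ ‖h‖)

/-- The constant `γ_{d,p} = ∫_{S^{d-1}} |σ · e|^p dσ`, where `dσ` is the surface measure of the
unit sphere (counting measure on the two points `±1` if `d = 1`); its value is the same for all
unit vectors `e`. -/
noncomputable def sphereGamma {d : ℕ} (p : ℝ)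
    (e : Metric.sphere (0 : EuclideanSpace ℝ (Fin d)) 1) : ℝ :=
  ∫ σ : Metric.sphere (0 : EuclideanSpace ℝ (Fin d)) 1,
    |inner ℝ (σ : EuclideanSpace ℝ (Fin d)) (e : EuclideanSpace ℝ (Fin d))| ^ p
      ∂((volume : Measure (EuclideanSpace ℝ (Fin d))).toSphere)

/-! For almost every `x` and then almost every `h`, `u (x + h) - u x` is the integral of `∇u(x + t
h) · h` over `t ∈ (0, 1]`. Hence the Taylor remainder divided by `|h|` is at most the mean of `|∇u(x
+ t h) - ∇u(x)|` over the segment, and Jensen's inequality moves the power `p` inside. With `w z =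
|∇u(x + z) - ∇u(x)| ^ p` and `W r` the integral of `w (r σ)` over the unit sphere, polar coordinates
reduce the first limit to the averages `(1/r) ∫₀^r W`, integrated against the density `r ^ (d - 1)
ρ_n(r)` of mass one.

If `x` is a Lebesgue point of order `p` of the gradient, then `∫₀^s t ^ (d - 1) W(t) dt = o(s ^ d)`.
The weight degenerates at `0`, but a dyadic decomposition
(`lintegral_Ioc_le_of_forall_lintegral_mul_pow_le`) removes it and gives `∫₀^r W = o(r)`. So the
averages tend to `0` with `r` and are bounded on `(0, 1]`, and concentration of the mollifiers
concludes (`tendsto_lintegral_segment_mul_norm`).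

For the second limit, `|V · h| / |h|` does not depend on the radius, so its `p`-th power integrates
to exactly `γ |V| ^ p` for every `n`. Minkowski's inequality in `L^p(ρ_n(|h|) dh)` then absorbs the
vanishing remainder (`tendsto_lintegral_rpow_of_tendsto_zero`). -/

/-! ### Polar coordinates and removal of the radial weight -/

/-- Integration in polar coordinates, for nonnegative functions. -/
theorem lintegral_polar {E : Type*} [NormedAddCommGroup E] [NormedSpace ℝ E] [MeasurableSpace E]
    [BorelSpace E] [FiniteDimensional ℝ E] [Nontrivial E] (μ : Measure E) [μ.IsAddHaarMeasure]
    {f : E → ℝ≥0∞} (hf : Measurable f) :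
    ∫⁻ x, f x ∂μ = ∫⁻ r in Ioi (0 : ℝ), ENNReal.ofReal (r ^ (Module.finrank ℝ E - 1)) *
      ∫⁻ σ : Metric.sphere (0 : E) 1, f (r • (σ : E)) ∂μ.toSphere := by
  have hm : Measurable fun q : Metric.sphere (0 : E) 1 × Ioi (0 : ℝ) =>
      f ((q.2 : ℝ) • (q.1 : E)) := by
    apply hf.comp
    fun_prop
  have hm' : Measurable fun r : ℝ =>
      ∫⁻ σ : Metric.sphere (0 : E) 1, f (r • (σ : E)) ∂μ.toSphere := by
    apply Measurable.lintegral_prod_right'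
      (f := fun (q : ℝ × Metric.sphere (0 : E) 1) => f (q.1 • (q.2 : E)))
    apply hf.comp
    fun_prop
  calc
    ∫⁻ x, f x ∂μ = ∫⁻ x : ({(0 : E)}ᶜ : Set E), f x ∂(μ.comap (↑)) := by
      rw [lintegral_subtype_comap (measurableSet_singleton _).compl f, restrict_compl_singleton]
    _ = ∫⁻ x : ({(0 : E)}ᶜ : Set E), (fun q : Metric.sphere (0 : E) 1 × Ioi (0 : ℝ) =>
          f ((q.2 : ℝ) • (q.1 : E))) (homeomorphUnitSphereProd E x) ∂(μ.comap (↑)) := by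
      refine lintegral_congr fun x => ?_
      have hx : ‖(x : E)‖ ≠ 0 := norm_ne_zero_iff.2 x.2
      simp [smul_smul, hx]
    _ = ∫⁻ q : Metric.sphere (0 : E) 1 × Ioi (0 : ℝ), f ((q.2 : ℝ) • (q.1 : E))
          ∂(μ.toSphere.prod (.volumeIoiPow (Module.finrank ℝ E - 1))) :=
      μ.measurePreserving_homeomorphUnitSphereProd.lintegral_comp hm
    _ = _ := by
      rw [lintegral_prod_symm' _ hm, Measure.volumeIoiPow,
        lintegral_withDensity_eq_lintegral_mul (g := fun r : Ioi (0 : ℝ) =>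
          ∫⁻ σ : Metric.sphere (0 : E) 1, f ((r : ℝ) • (σ : E)) ∂μ.toSphere) _ (by fun_prop)
          (hm'.comp measurable_subtype_coe)]
      exact lintegral_subtype_comap measurableSet_Ioi
        (fun r : ℝ => ENNReal.ofReal (r ^ (Module.finrank ℝ E - 1)) *
          ∫⁻ σ : Metric.sphere (0 : E) 1, f (r • (σ : E)) ∂μ.toSphere)

/-- A property of almost every radius holds at the norm of almost every point. -/
theorem ae_norm_of_ae {E : Type*} [NormedAddCommGroup E] [NormedSpace ℝ E] [MeasurableSpace E]
    [BorelSpace E] [FiniteDimensional ℝ E] [Nontrivial E] (μ : Measure E) [μ.IsAddHaarMeasure]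
    {P : ℝ → Prop} (hP : ∀ᵐ r : ℝ, 0 < r → P r) : ∀ᵐ x ∂μ, P ‖x‖ := by
  obtain ⟨N, hN, hNm, hN0⟩ := exists_measurable_superset_of_null (ae_iff.1 hP)
  have hnull : μ ((fun x => ‖x‖) ⁻¹' N) = 0 := by
    have hmeas : MeasurableSet ((fun x : E => ‖x‖) ⁻¹' N) := measurable_norm hNm
    rw [← lintegral_indicator_one hmeas,
      lintegral_polar μ (measurable_one.indicator hmeas)]
    refine (lintegral_congr_ae ?_).trans lintegral_zero
    have hN' : ∀ᵐ r ∂(volume.restrict (Ioi (0 : ℝ))), r ∉ N :=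
      ae_restrict_of_ae (measure_eq_zero_iff_ae_notMem.1 hN0)
    filter_upwards [hN', ae_restrict_mem measurableSet_Ioi] with r hr hr0
    have hr0' : |r| = r := abs_of_pos hr0
    simp [norm_smul, hr0', hr]
  -- The origin is discarded because `P` is known at positive radii only.
  filter_upwards [measure_eq_zero_iff_ae_notMem.1 hnull,
    (measure_eq_zero_iff_ae_notMem.1 (measure_singleton (μ := μ) (0 : E)))] with x hx hx0
  by_contra hcon
  exact hx (hN fun h => hcon (h (norm_pos_iff.2 hx0)))

/-- On the dyadic shell `(s/2, s]` the weight is at least `(s/2) ^ (d - 1)`, so dividing it out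
leaves at most `2 ^ (d - 1) * K * s`. Summing over `s = r / 2 ^ k` gives the remaining factor `2`.
-/
theorem lintegral_Ioc_le_of_forall_lintegral_mul_pow_le {Φ : ℝ → ℝ≥0∞} {d : ℕ} (hd : 1 ≤ d)
    {R : ℝ} {K : ℝ≥0∞}
    (h : ∀ s, 0 < s → s ≤ R →
      ∫⁻ t in Ioc 0 s, ENNReal.ofReal (t ^ (d - 1)) * Φ t ≤ K * ENNReal.ofReal (s ^ d))
    {r : ℝ} (hr : 0 < r) (hrR : r ≤ R) :
    ∫⁻ t in Ioc 0 r, Φ t ≤ 2 ^ d * K * ENNReal.ofReal r := by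
  obtain ⟨m, rfl⟩ : ∃ m, d = m + 1 := ⟨d - 1, by omega⟩
  simp only [Nat.add_sub_cancel] at h
  let s : ℕ → ℝ := fun k => r * (1 / 2) ^ k
  have hs0 : ∀ k, 0 < s k := fun k => by positivity
  have hs_succ : ∀ k, s (k + 1) = s k / 2 := fun k => by simp only [s]; ring
  have hsR : ∀ k, s k ≤ R := fun k =>
    le_trans (mul_le_of_le_one_right hr.le (pow_le_one₀ (by norm_num) (by norm_num))) hrR
  have hlim : Tendsto s atTop (𝓝 0) := by
    simpa [s] using (tendsto_pow_atTop_nhds_zero_of_lt_one (r := (1 / 2 : ℝ))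
      (by norm_num) (by norm_num)).const_mul r
  have hcover : Ioc 0 r ⊆ ⋃ k, Ioc (s (k + 1)) (s k) := by
    intro t ht
    have hex : ∃ k, s k < t := ((hlim.eventually_lt_const ht.1)).exists
    classical
    have hspec := Nat.find_spec hex
    have hne : Nat.find hex ≠ 0 := by
      intro h0
      rw [h0] at hspec
      simp only [s, pow_zero, mul_one] at hspec
      exact absurd ht.2 (not_le.2 hspec)
    obtain ⟨k, hk⟩ := Nat.exists_eq_succ_of_ne_zero hne
    refine mem_iUnion.2 ⟨k, ?_, not_lt.1 (Nat.find_min hex (by omega))⟩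
    rwa [hk] at hspec
  have hpiece : ∀ k, ∫⁻ t in Ioc (s (k + 1)) (s k), Φ t ≤
      2 ^ m * K * ENNReal.ofReal (s k) := by
    intro k
    set c : ℝ≥0∞ := ENNReal.ofReal (s (k + 1) ^ m) with hc
    have hc0 : c ≠ 0 := by
      rw [hc, ENNReal.ofReal_ne_zero_iff]
      exact pow_pos (hs0 _) _
    have hct : c ≠ ⊤ := ENNReal.ofReal_ne_top
    have h1 : c * ∫⁻ t in Ioc (s (k + 1)) (s k), Φ t ≤ K * ENNReal.ofReal (s k ^ (m + 1)) := by
      rw [← lintegral_const_mul' _ _ hct]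
      refine le_trans ?_ (h (s k) (hs0 k) (hsR k))
      calc ∫⁻ t in Ioc (s (k + 1)) (s k), c * Φ t
          ≤ ∫⁻ t in Ioc (s (k + 1)) (s k), ENNReal.ofReal (t ^ m) * Φ t := by
            refine setLIntegral_mono' measurableSet_Ioc fun t ht => ?_
            have := (hs0 (k + 1)).le
            have := ht.1.le
            gcongr
            rw [hc]
            gcongr
        _ ≤ _ := lintegral_mono_set (Ioc_subset_Ioc_left (hs0 _).le)
    have h2 : K * ENNReal.ofReal (s k ^ (m + 1)) = c * (2 ^ m * K * ENNReal.ofReal (s k)) := by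
      have : ENNReal.ofReal (s k ^ (m + 1)) = c * (2 ^ m * ENNReal.ofReal (s k)) := by
        rw [hc, show (2 : ℝ≥0∞) ^ m = ENNReal.ofReal (2 ^ m) by
          rw [ENNReal.ofReal_pow (by norm_num)]; simp, ← ENNReal.ofReal_mul (by positivity),
          ← ENNReal.ofReal_mul (pow_nonneg (hs0 _).le _), hs_succ, div_pow]
        congr 1
        field_simp
        rw [pow_succ]
      rw [this]
      ring
    rw [h2] at h1
    exact (ENNReal.mul_le_mul_iff_right hc0 hct).1 h1
  have hsum : ∑' k, ENNReal.ofReal (s k) = 2 * ENNReal.ofReal r := by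
    have : ∀ k, ENNReal.ofReal (s k) = ENNReal.ofReal r * (2⁻¹ : ℝ≥0∞) ^ k := by
      intro k
      simp only [s]
      rw [ENNReal.ofReal_mul hr.le, ENNReal.ofReal_pow (by norm_num), one_div,
        ENNReal.ofReal_inv_of_pos (by norm_num)]
      simp
    simp_rw [this]
    rw [ENNReal.tsum_mul_left, ENNReal.tsum_geometric, ENNReal.one_sub_inv_two, inv_inv, mul_comm]
  calc ∫⁻ t in Ioc 0 r, Φ t ≤ ∫⁻ t in ⋃ k, Ioc (s (k + 1)) (s k), Φ t := lintegral_mono_set hcover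
    _ ≤ ∑' k, ∫⁻ t in Ioc (s (k + 1)) (s k), Φ t := lintegral_iUnion_le _ _
    _ ≤ ∑' k, 2 ^ m * K * ENNReal.ofReal (s k) := ENNReal.tsum_le_tsum hpiece
    _ = _ := by rw [ENNReal.tsum_mul_left, hsum, pow_succ]; ring

/-! ### Weak gradients and integration along segments -/

theorem MeasureTheory.LocallyIntegrable.clm_comp {X F F' : Type*} [TopologicalSpace X] [MeasurableSpace X]
    [NormedAddCommGroup F] [NormedSpace ℝ F] [NormedAddCommGroup F'] [NormedSpace ℝ F']
    {μ : Measure X} {f : X → F} (hf : LocallyIntegrable f μ) (L : F →L[ℝ] F') :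
    LocallyIntegrable (fun x => L (f x)) μ := by
  intro x
  obtain ⟨s, hs, hi⟩ := hf x
  exact ⟨s, hs, L.integrable_comp hi⟩

section WeakGradient

variable {d : ℕ} {u : EuclideanSpace ℝ (Fin d) → ℝ}
  {g g' : EuclideanSpace ℝ (Fin d) → EuclideanSpace ℝ (Fin d)}

theorem HasWeakGradient.ae_eq (hg : HasWeakGradient u g) (hg' : HasWeakGradient u g') :
    g =ᵐ[volume] g' := by
  have h : ∀ i, ∀ᵐ x, g x i = g' x i := fun i => by
    refine ae_eq_of_integral_contDiff_smul_eq
      (hg.locallyIntegrable_grad.clm_comp (EuclideanSpace.proj i))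
      (hg'.locallyIntegrable_grad.clm_comp (EuclideanSpace.proj i)) fun φ hφ hφc => ?_
    have h1 := hg.integral_eq φ hφ hφc i
    have h2 := hg'.integral_eq φ hφ hφc i
    have h3 : ∫ x, g x i * φ x = ∫ x, g' x i * φ x := by linarith
    simpa [mul_comm] using h3
  filter_upwards [ae_all_iff.2 h] with x hx
  ext i
  exact hx i

theorem HasWeakGradient.congr {v : EuclideanSpace ℝ (Fin d) → ℝ} (hg : HasWeakGradient u g)
    (hu : u =ᵐ[volume] v) (hgg' : g =ᵐ[volume] g') : HasWeakGradient v g' where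
  locallyIntegrable := hg.locallyIntegrable.congr hu
  locallyIntegrable_grad := hg.locallyIntegrable_grad.congr hgg'
  integral_eq φ hφ hφc i := by
    have h1 : ∫ x, v x * fderiv ℝ φ x (EuclideanSpace.single i 1) =
        ∫ x, u x * fderiv ℝ φ x (EuclideanSpace.single i 1) := by
      refine integral_congr_ae ?_
      filter_upwards [hu] with x hx
      rw [hx]
    have h2 : ∫ x, g' x i * φ x = ∫ x, g x i * φ x := by
      refine integral_congr_ae ?_
      filter_upwards [hgg'] with x hx
      rw [hx]
    rw [h1, h2, hg.integral_eq φ hφ hφc i]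

theorem HasWeakGradient.integral_mul_fderiv (hg : HasWeakGradient u g)
    {φ : EuclideanSpace ℝ (Fin d) → ℝ} (hφ : ContDiff ℝ ∞ φ) (hφc : HasCompactSupport φ)
    (h : EuclideanSpace ℝ (Fin d)) :
    ∫ x, u x * fderiv ℝ φ x h = -∫ x, inner ℝ (g x) h * φ x := by
  have hsum : h = ∑ i, h i • EuclideanSpace.single i (1 : ℝ) := by
    ext j
    simp [Finset.sum_apply, Pi.single_apply]
  have hD : ∀ v, Continuous fun x => fderiv ℝ φ x v := fun v =>
    (hφ.continuous_fderiv (by simp)).clm_apply continuous_const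
  have hDc : ∀ v, HasCompactSupport fun x => fderiv ℝ φ x v := fun v =>
    hφc.fderiv_apply (𝕜 := ℝ) v
  have e1 : ∀ x, u x * fderiv ℝ φ x h =
      ∑ i, h i * (u x * fderiv ℝ φ x (EuclideanSpace.single i 1)) := by
    intro x
    conv_lhs => rw [hsum]
    simp only [map_sum, map_smul, smul_eq_mul, Finset.mul_sum]
    exact Finset.sum_congr rfl fun i _ => by ring
  have e2 : ∀ x, inner ℝ (g x) h * φ x = ∑ i, h i * (g x i * φ x) := by
    intro x
    simp only [PiLp.inner_apply, RCLike.inner_apply, conj_trivial, Finset.sum_mul]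
    exact Finset.sum_congr rfl fun i _ => by ring
  simp_rw [e1, e2]
  rw [integral_finsetSum, integral_finsetSum, ← Finset.sum_neg_distrib]
  · refine Finset.sum_congr rfl fun i _ => ?_
    rw [integral_const_mul, integral_const_mul, hg.integral_eq φ hφ hφc i, mul_neg]
  · intro i _
    refine Integrable.const_mul ?_ _
    have := (hg.locallyIntegrable_grad.clm_comp
      (EuclideanSpace.proj i)).integrable_smul_left_of_hasCompactSupport hφ.continuous hφc
    simpa [mul_comm] using this
  · intro i _
    refine Integrable.const_mul ?_ _
    have := hg.locallyIntegrable.integrable_smul_left_of_hasCompactSupport (hD _) (hDc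
      (EuclideanSpace.single i 1))
    simpa [mul_comm] using this

/-- Fubini along segments: a locally integrable function is jointly integrable in the base point
(in a ball) and in the parameter of the segment from `x` to `x + h`. -/
theorem integrableOn_comp_add_smul {E F : Type*} [NormedAddCommGroup E] [NormedSpace ℝ E]
    [MeasurableSpace E] [BorelSpace E] [FiniteDimensional ℝ E] {μ : Measure E}
    [μ.IsAddHaarMeasure] [NormedAddCommGroup F] [MeasurableSpace F] [BorelSpace F]
    [SecondCountableTopology F]
    {f : E → F} (hf : LocallyIntegrable f μ) (hfm : Measurable f) (h : E) (R : ℝ) :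
    Integrable (fun q : E × ℝ => f (q.1 + q.2 • h))
      ((μ.restrict (Metric.closedBall 0 R)).prod (volume.restrict (Ioc (0 : ℝ) 1))) := by
  have hm : Measurable fun q : E × ℝ => f (q.1 + q.2 • h) := by
    apply hfm.comp
    fun_prop
  refine ⟨hm.aestronglyMeasurable, ?_⟩
  rw [hasFiniteIntegral_iff_enorm, lintegral_prod_symm' _ (by fun_prop)]
  set C := ∫⁻ x in Metric.closedBall 0 (R + ‖h‖), ‖f x‖ₑ ∂μ with hC
  have hCt : C < ⊤ := (hf.integrableOn_isCompact (isCompact_closedBall 0 (R + ‖h‖))).2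
  calc _ ≤ ∫⁻ _ in Ioc (0 : ℝ) 1, C := by
        refine setLIntegral_mono' measurableSet_Ioc fun t ht => ?_
        have hsub : Metric.closedBall (0 : E) R ⊆
            (fun x => x + t • h) ⁻¹' Metric.closedBall 0 (R + ‖h‖) := by
          intro x hx
          simp only [mem_preimage, mem_closedBall_zero_iff] at hx ⊢
          refine (norm_add_le _ _).trans (add_le_add hx ?_)
          rw [norm_smul, Real.norm_of_nonneg ht.1.le]
          exact mul_le_of_le_one_left (norm_nonneg _) ht.2
        refine (lintegral_mono_set hsub).trans_eq ?_
        exact ((measurePreserving_add_right μ (t • h)).setLIntegral_comp_preimage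
          Metric.isClosed_closedBall.measurableSet hfm.enorm)
    _ < ⊤ := by simpa using hCt


/-- Serves the Fubini exchanges in `ae_sub_eq_integral`: `F` is integrable only over a bounded set
of base points, and the support of the test function kills the product elsewhere. -/
theorem integrable_prod_mul_of_bounded {X Y : Type*} [MeasurableSpace X] [MeasurableSpace Y]
    {μ : Measure X} {ν : Measure Y} [SFinite μ] [SFinite ν] {s : Set X} {T : Set Y}
    (hT : MeasurableSet T) {F b : X × Y → ℝ}
    (hF : Integrable F ((μ.restrict s).prod (ν.restrict T))) (hb : Measurable b) {C : ℝ}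
    (hbC : ∀ q, ‖b q‖ ≤ C) (hb0 : ∀ q, q.1 ∉ s → q.2 ∈ T → F q * b q = 0) :
    Integrable (fun q => F q * b q) (μ.prod (ν.restrict T)) := by
  have h1 : Integrable (fun q => F q * b q) ((μ.restrict s).prod (ν.restrict T)) :=
    hF.mul_bdd hb.aestronglyMeasurable (ae_of_all _ hbC)
  rw [Measure.prod_restrict] at h1
  rw [← Measure.restrict_univ (μ := μ), Measure.prod_restrict]
  refine IntegrableOn.of_forall_sdiff_eq_zero h1 (MeasurableSet.univ.prod hT) ?_
  rintro q ⟨⟨-, hqT⟩, hq⟩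
  exact hb0 q (fun h => hq ⟨h, hqT⟩) hqT

/-- Both sides are locally integrable in `x`, so it suffices to test them against smooth compactly
supported `φ`. The translation is moved onto `φ`, to which the fundamental theorem of calculus
applies; the weak derivative is then used for each `t`. -/
theorem HasWeakGradient.ae_sub_eq_integral (hg : HasWeakGradient u g) (hgm : Measurable g)
    (h : EuclideanSpace ℝ (Fin d)) :
    ∀ᵐ x, IntegrableOn (fun t : ℝ => g (x + t • h)) (Ioc 0 1) ∧
      u (x + h) - u x = ∫ t in Ioc (0 : ℝ) 1, inner ℝ (g (x + t • h)) h := by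
  have hint := fun R => integrableOn_comp_add_smul hg.locallyIntegrable_grad hgm h R
  have hinner : ∀ R, Integrable (fun q : EuclideanSpace ℝ (Fin d) × ℝ =>
      (inner ℝ (g (q.1 + q.2 • h)) h : ℝ))
      ((volume.restrict (Metric.closedBall 0 R)).prod (volume.restrict (Ioc (0 : ℝ) 1))) :=
    fun R => (hint R).inner_const h
  have hI : LocallyIntegrable (fun x => ∫ t in Ioc (0 : ℝ) 1, (inner ℝ (g (x + t • h)) h : ℝ)) := by
    intro x
    refine ⟨Metric.closedBall 0 (‖x‖ + 1), ?_, (hinner (‖x‖ + 1)).integral_prod_left⟩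
    refine mem_of_superset (Metric.ball_mem_nhds x one_pos) fun y hy => ?_
    rw [mem_closedBall_zero_iff]
    rw [mem_ball_iff_norm] at hy
    linarith [norm_le_norm_add_norm_sub' y x]
  have hshift : LocallyIntegrable (fun x => u (x + h)) := by
    intro x
    obtain ⟨s, hs, hi⟩ := hg.locallyIntegrable (x + h)
    refine ⟨(fun y => y + h) ⁻¹' s, (continuous_add_const h).continuousAt.preimage_mem_nhds hs, ?_⟩
    exact (((measurePreserving_add_right volume h).integrableOn_comp_preimage
      (measurableEmbedding_addRight h))).2 hi
  have hmain : ∀ᵐ x, u (x + h) - u x = ∫ t in Ioc (0 : ℝ) 1, inner ℝ (g (x + t • h)) h := by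
    refine ae_eq_of_integral_contDiff_smul_eq (hshift.sub hg.locallyIntegrable) hI
      fun φ hφ hφc => ?_
    obtain ⟨R, hR⟩ := hφc.isCompact.isBounded.subset_closedBall 0
    have hφR : ∀ x, x ∉ Metric.closedBall 0 R → φ x = 0 := fun x hx =>
      image_eq_zero_of_notMem_tsupport fun h => hx (hR h)
    have hDφR : ∀ x, x ∉ Metric.closedBall 0 R → fderiv ℝ φ x = 0 := fun x hx =>
      image_eq_zero_of_notMem_tsupport fun h => hx (hR (tsupport_fderiv_subset ℝ h))
    obtain ⟨Cφ, hCφ⟩ := hφc.exists_bound_of_continuous hφ.continuous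
    have hDcont : Continuous (fderiv ℝ φ) := hφ.continuous_fderiv (by simp)
    obtain ⟨CD, hCD⟩ := (hφc.fderiv (𝕜 := ℝ)).exists_bound_of_continuous hDcont
    have hmem : ∀ {x : EuclideanSpace ℝ (Fin d)} {t : ℝ}, t ∈ Ioc (0 : ℝ) 1 →
        x ∉ Metric.closedBall 0 (R + ‖h‖) → x - t • h ∉ Metric.closedBall 0 R := by
      intro x t ht hx hx'
      apply hx
      rw [mem_closedBall_zero_iff] at hx' ⊢
      have h1 : ‖t • h‖ ≤ ‖h‖ := by
        rw [norm_smul, Real.norm_of_nonneg ht.1.le]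
        exact mul_le_of_le_one_left (norm_nonneg _) ht.2
      linarith [norm_le_norm_add_norm_sub' x (t • h), norm_sub_norm_le x (t • h)]
    have hφh : HasCompactSupport fun x => φ (x - h) := by
      simpa [sub_eq_add_neg, Function.comp_def] using hφc.comp_homeomorph (Homeomorph.addRight (-h))
    have htrans : ∀ t : ℝ, ContDiff ℝ ∞ (fun x => φ (x - t • h)) := fun t =>
      hφ.comp (contDiff_id.sub contDiff_const)
    have htransc : ∀ t : ℝ, HasCompactSupport (fun x => φ (x - t • h)) := fun t => by
      simpa [sub_eq_add_neg, Function.comp_def] using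
        hφc.comp_homeomorph (Homeomorph.addRight (-(t • h)))
    have hDtrans : ∀ (t : ℝ) x, fderiv ℝ (fun x => φ (x - t • h)) x = fderiv ℝ φ (x - t • h) :=
      fun t x => fderiv_comp_sub (f := φ) (t • h)
    have hftc : ∀ x, φ (x - h) - φ x = ∫ t in Ioc (0 : ℝ) 1, -(fderiv ℝ φ (x - t • h) h) := by
      intro x
      rw [← intervalIntegral.integral_of_le zero_le_one,
        intervalIntegral.integral_eq_sub_of_hasDerivAt (f := fun t : ℝ => φ (x - t • h))]
      · simp
      · intro t _
        have h1 : HasDerivAt (fun t : ℝ => x - t • h) (-h) t := by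
          simpa using ((hasDerivAt_id t).smul_const h).const_sub x
        have h2 := ((hφ.differentiable (by simp)) (x - t • h)).hasFDerivAt.comp_hasDerivAt t h1
        simpa [Function.comp_def] using h2
      · apply Continuous.intervalIntegrable
        fun_prop
    calc ∫ x, φ x • (u (x + h) - u x)
        = ∫ x, u x * (φ (x - h) - φ x) := by
          have i1 : Integrable fun x => φ x * u (x + h) :=
            hshift.integrable_smul_left_of_hasCompactSupport hφ.continuous hφc
          have i2 : Integrable fun x => φ x * u x :=
            hg.locallyIntegrable.integrable_smul_left_of_hasCompactSupport hφ.continuous hφc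
          have i3 : Integrable fun x => φ (x - h) * u x :=
            hg.locallyIntegrable.integrable_smul_left_of_hasCompactSupport
              (hφ.continuous.comp (by fun_prop)) hφh
          have e := integral_add_right_eq_self (μ := volume) (fun x => φ (x - h) * u x) h
          simp only [add_sub_cancel_right] at e
          simp only [smul_eq_mul, mul_sub, mul_comm (u _), sub_mul]
          rw [integral_sub i1 i2, integral_sub i3 i2, e]
      _ = ∫ x, ∫ t in Ioc (0 : ℝ) 1, u x * -(fderiv ℝ φ (x - t • h) h) := by
          simp_rw [integral_const_mul, ← hftc]
      _ = ∫ t in Ioc (0 : ℝ) 1, ∫ x, u x * -(fderiv ℝ φ (x - t • h) h) := by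
          refine integral_integral_swap ?_
          refine integrable_prod_mul_of_bounded (s := Metric.closedBall 0 (R + ‖h‖))
            (F := fun q => u q.1) (C := CD * ‖h‖) measurableSet_Ioc
            ((hg.locallyIntegrable.integrableOn_isCompact (isCompact_closedBall _ _)).comp_fst _)
            (b := fun q => -(fderiv ℝ φ (q.1 - q.2 • h) h)) ?_ (fun q => ?_) fun q hq ht => ?_
          · have : Continuous fun q : EuclideanSpace ℝ (Fin d) × ℝ =>
                -(fderiv ℝ φ (q.1 - q.2 • h) h) := by fun_prop
            exact this.measurable
          · rw [norm_neg]
            exact (ContinuousLinearMap.le_opNorm _ _).trans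
              (mul_le_mul_of_nonneg_right (hCD _) (norm_nonneg _))
          · simp [hDφR _ (hmem ht hq)]
      _ = ∫ t in Ioc (0 : ℝ) 1, ∫ x, inner ℝ (g (x + t • h)) h * φ x := by
          congr 1
          ext t
          have e1 := hg.integral_mul_fderiv (htrans t) (htransc t) h
          have e2 := integral_add_right_eq_self (μ := volume)
            (fun x => inner ℝ (g x) h * φ (x - t • h)) (t • h)
          simp only [add_sub_cancel_right] at e2
          simp only [hDtrans] at e1
          simp only [mul_neg, integral_neg, e1, neg_neg, e2]
      _ = ∫ x, ∫ t in Ioc (0 : ℝ) 1, inner ℝ (g (x + t • h)) h * φ x := by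
          refine (integral_integral_swap ?_).symm
          refine integrable_prod_mul_of_bounded (C := Cφ) measurableSet_Ioc
            (hinner R) (b := fun q => φ q.1) (hφ.continuous.measurable.comp measurable_fst)
            (fun q => hCφ _) fun q hq => ?_
          simp [hφR _ hq]
      _ = _ := by
          simp_rw [integral_mul_const, smul_eq_mul, mul_comm]
  -- Joint integrability is available over bounded sets of base points; balls of integer radius
  -- exhaust the space at the cost of countably many null sets.
  have hball : ∀ᵐ x, ∀ n : ℕ, x ∈ Metric.closedBall (0 : EuclideanSpace ℝ (Fin d)) n →
      IntegrableOn (fun t : ℝ => g (x + t • h)) (Ioc 0 1) := by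
    refine ae_all_iff.2 fun n => ?_
    exact (ae_restrict_iff' Metric.isClosed_closedBall.measurableSet).1 (hint n).prod_right_ae
  filter_upwards [hmain, hball] with x hx hxb
  refine ⟨?_, hx⟩
  obtain ⟨n, hn⟩ := exists_nat_ge ‖x‖
  exact hxb n (by simpa using hn)

/-- The segment formula has a null set of `x` depending on `h`; Fubini exchanges the quantifiers.
This needs the set of good pairs to be measurable, whence the genuinely measurable `u` and `g`. -/
theorem HasWeakGradient.ae_ae_enorm_remainder_le (hg : HasWeakGradient u g) (hum : Measurable u)
    (hgm : Measurable g) :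
    ∀ᵐ x, ∀ᵐ h, ‖u (x + h) - u x - inner ℝ (g x) h‖ₑ ≤
      ‖h‖ₑ * ∫⁻ t in Ioc (0 : ℝ) 1, ‖g (x + t • h) - g x‖ₑ := by
  refine (Measure.ae_ae_comm (μ := volume) (ν := volume) ?_).1 (ae_of_all _ fun h => ?_)
  · refine measurableSet_le ?_ ?_
    · fun_prop
    · refine Measurable.mul (by fun_prop) ?_
      apply Measurable.lintegral_prod_right' (f := fun q : (EuclideanSpace ℝ (Fin d) ×
        EuclideanSpace ℝ (Fin d)) × ℝ => ‖g (q.1.2 + q.2 • q.1.1) - g q.1.2‖ₑ)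
      fun_prop
  · filter_upwards [hg.ae_sub_eq_integral hgm h] with x hx
    have hc : IntegrableOn (fun _ : ℝ => g x) (Ioc 0 1) := integrableOn_const (by simp)
    have e : u (x + h) - u x - inner ℝ (g x) h =
        ∫ t in Ioc (0 : ℝ) 1, inner ℝ (g (x + t • h) - g x) h := by
      simp_rw [inner_sub_left]
      rw [integral_sub (hx.1.inner_const h) (hc.inner_const h), hx.2]
      simp
    rw [e]
    refine (enorm_integral_le_lintegral_enorm _).trans ?_
    rw [← lintegral_const_mul' _ _ enorm_ne_top]
    refine lintegral_mono fun t => ?_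
    rw [← ofReal_norm, ← ofReal_norm, ← ofReal_norm, ← ENNReal.ofReal_mul (norm_nonneg _), mul_comm]
    exact ENNReal.ofReal_le_ofReal (norm_inner_le_norm _ _)

/-- Jensen's inequality on the unit interval, for nonnegative functions. -/
theorem rpow_lintegral_Ioc_le {f : ℝ → ℝ≥0∞} (hf : Measurable f) {p : ℝ} (hp : 1 ≤ p) :
    (∫⁻ t in Ioc (0 : ℝ) 1, f t) ^ p ≤ ∫⁻ t in Ioc (0 : ℝ) 1, f t ^ p := by
  have : IsProbabilityMeasure (volume.restrict (Ioc (0 : ℝ) 1)) := ⟨by simp⟩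
  have h := eLpNorm'_le_eLpNorm'_of_exponent_le one_pos hp (volume.restrict (Ioc (0 : ℝ) 1))
    hf.aestronglyMeasurable
  simp only [eLpNorm', enorm_eq_self, ENNReal.rpow_one, div_one] at h
  rwa [← ENNReal.le_rpow_inv_iff (by linarith), ← one_div]

end WeakGradient

/-! ### Lebesgue points of order `p` -/

theorem MemLpLoc.locallyIntegrable_norm_sub_rpow {d : ℕ} {F : Type*} [NormedAddCommGroup F]
    {p : ℝ} (hp : 1 ≤ p) {g : EuclideanSpace ℝ (Fin d) → F} (hg : MemLpLoc p g) (c : F) :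
    LocallyIntegrable (fun y => ‖g y - c‖ ^ p) := by
  rw [locallyIntegrable_iff]
  intro k hk
  have : IsFiniteMeasure (volume.restrict k) := ⟨by simpa using hk.measure_lt_top⟩
  have h := ((hg k hk).sub (memLp_const c)).integrable_norm_rpow
    (by simpa using by linarith) ENNReal.ofReal_ne_top
  rw [ENNReal.toReal_ofReal (by linarith : 0 ≤ p)] at h
  exact h

theorem MemLpLoc.lintegral_enorm_sub_rpow_lt_top {d : ℕ} {F : Type*} [NormedAddCommGroup F]
    {p : ℝ} (hp : 1 ≤ p) {g : EuclideanSpace ℝ (Fin d) → F} (hg : MemLpLoc p g) (c : F)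
    {k : Set (EuclideanSpace ℝ (Fin d))} (hk : IsCompact k) :
    ∫⁻ y in k, ‖g y - c‖ₑ ^ p < ⊤ := by
  have h := ((hg.locallyIntegrable_norm_sub_rpow hp c).integrableOn_isCompact hk).2
  rw [hasFiniteIntegral_iff_enorm] at h
  refine lt_of_eq_of_lt (lintegral_congr fun y => ?_) h
  rw [Real.enorm_rpow_of_nonneg (norm_nonneg _) (by linarith), enorm_norm]

/-- Almost every point is a Lebesgue point of order `p` of a function in `L^p_loc`. -/
theorem MemLpLoc.ae_tendsto_lintegral_enorm_sub_rpow_div {d : ℕ} {F : Type*}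
    [NormedAddCommGroup F] [SecondCountableTopology F]
    {p : ℝ} (hp : 1 ≤ p) {g : EuclideanSpace ℝ (Fin d) → F} (hg : MemLpLoc p g) :
    ∀ᵐ x, Tendsto (fun s : ℝ => (∫⁻ y in Metric.closedBall x s, ‖g y - g x‖ₑ ^ p) /
      volume (Metric.closedBall x s)) (𝓝[>] 0) (𝓝 0) := by
  have hp0 : 0 ≤ p := by linarith
  -- Ordinary differentiation is applied to `‖g - c‖ ^ p` for `c` in a countable dense set, so that
  -- one null set serves all `c`; below, `c` is chosen close to `g x`.
  have hdiff : ∀ n : ℕ, ∀ᵐ x, Tendsto (fun s : ℝ => (∫⁻ y in Metric.closedBall x s,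
      ‖‖g y - TopologicalSpace.denseSeq F n‖ ^ p - ‖g x - TopologicalSpace.denseSeq F n‖ ^ p‖ₑ) /
      volume (Metric.closedBall x s)) (𝓝[>] 0) (𝓝 0) := fun n => by
    filter_upwards [(Besicovitch.vitaliFamily volume).ae_tendsto_lintegral_enorm_sub_div
      (hg.locallyIntegrable_norm_sub_rpow hp (TopologicalSpace.denseSeq F n))] with x hx
    exact hx.comp (Besicovitch.tendsto_filterAt volume x)
  filter_upwards [ae_all_iff.2 hdiff] with x hx
  rw [ENNReal.tendsto_nhds_zero]
  intro ε hε
  set C : ℝ≥0∞ := 2 ^ (p - 1) with hC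
  have hC0 : C ≠ 0 := by simp [hC]
  have hCt : C ≠ ⊤ := ENNReal.rpow_ne_top_of_nonneg (by linarith) (by simp)
  -- One `η` pays for the averaged oscillation of `‖g - c‖ ^ p`, two for `‖g x - c‖ ^ p`; `C` is the
  -- convexity constant of the `p`-th power of a sum.
  obtain ⟨η, hη0, hηε⟩ : ∃ η : ℝ≥0∞, 0 < η ∧ C * (3 * η) ≤ ε := by
    refine ⟨ε / (C * 3), ENNReal.div_pos hε.ne' (ENNReal.mul_ne_top hCt (by simp)), ?_⟩
    rw [← mul_assoc]
    exact ENNReal.mul_div_le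
  obtain ⟨n, hn⟩ : ∃ n, ‖g x - TopologicalSpace.denseSeq F n‖ₑ ^ p < η := by
    have hcont : Tendsto (fun c => ‖g x - c‖ₑ ^ p) (𝓝 (g x)) (𝓝 0) := by
      have : Continuous fun c => ‖g x - c‖ₑ ^ p := by fun_prop
      simpa [ENNReal.zero_rpow_of_pos (by linarith : 0 < p)] using this.tendsto (g x)
    exact (TopologicalSpace.denseRange_denseSeq F).exists_mem_open
      (s := {c | ‖g x - c‖ₑ ^ p < η}) (isOpen_lt (by fun_prop) continuous_const)
      ⟨g x, by simpa [ENNReal.zero_rpow_of_pos (by linarith : 0 < p)] using hη0⟩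
  set c := TopologicalSpace.denseSeq F n
  have henorm : ∀ y, ‖‖g y - c‖ ^ p‖ₑ = ‖g y - c‖ₑ ^ p := fun y => by
    rw [Real.enorm_rpow_of_nonneg (norm_nonneg _) hp0, enorm_norm]
  filter_upwards [(ENNReal.tendsto_nhds_zero.1 (hx n)) η hη0, self_mem_nhdsWithin] with s hs hs0
  have hv0 : volume (Metric.closedBall x s) ≠ 0 := (Metric.measure_closedBall_pos _ _ hs0).ne'
  have hvt : volume (Metric.closedBall x s) ≠ ⊤ := measure_closedBall_lt_top.ne
  rw [ENNReal.div_le_iff hv0 hvt] at hs ⊢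
  calc ∫⁻ y in Metric.closedBall x s, ‖g y - g x‖ₑ ^ p
      ≤ ∫⁻ y in Metric.closedBall x s, C * (‖‖g y - c‖ ^ p - ‖g x - c‖ ^ p‖ₑ + 2 * η) := by
        refine lintegral_mono fun y => ?_
        have h1 : ‖g y - g x‖ₑ ≤ ‖g y - c‖ₑ + ‖g x - c‖ₑ := by
          have := enorm_sub_le (a := g y - c) (b := g x - c)
          rwa [sub_sub_sub_cancel_right] at this
        have h2 : ‖g y - c‖ₑ ^ p ≤ ‖‖g y - c‖ ^ p - ‖g x - c‖ ^ p‖ₑ + η := by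
          rw [← henorm y]
          calc ‖‖g y - c‖ ^ p‖ₑ = ‖(‖g y - c‖ ^ p - ‖g x - c‖ ^ p) + ‖g x - c‖ ^ p‖ₑ := by
                rw [sub_add_cancel]
            _ ≤ _ := (enorm_add_le _ _).trans (by rw [henorm x]; gcongr)
        calc ‖g y - g x‖ₑ ^ p ≤ (‖g y - c‖ₑ + ‖g x - c‖ₑ) ^ p := by gcongr
          _ ≤ C * (‖g y - c‖ₑ ^ p + ‖g x - c‖ₑ ^ p) :=
            ENNReal.rpow_add_le_mul_rpow_add_rpow _ _ hp
          _ ≤ C * ((‖‖g y - c‖ ^ p - ‖g x - c‖ ^ p‖ₑ + η) + η) := by gcongr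
          _ = _ := by ring
    _ = C * ((∫⁻ y in Metric.closedBall x s, ‖‖g y - c‖ ^ p - ‖g x - c‖ ^ p‖ₑ) +
          2 * η * volume (Metric.closedBall x s)) := by
        rw [lintegral_const_mul' _ _ hCt, lintegral_add_right _ measurable_const,
          setLIntegral_const]
    _ ≤ C * (η * volume (Metric.closedBall x s) + 2 * η * volume (Metric.closedBall x s)) := by
        gcongr
    _ = C * (3 * η) * volume (Metric.closedBall x s) := by ring
    _ ≤ ε * volume (Metric.closedBall x s) := by gcongr

theorem MemLpLoc.ae_forall_exists_lintegral_le {d : ℕ} {F : Type*}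
    [NormedAddCommGroup F] [SecondCountableTopology F]
    {p : ℝ} (hp : 1 ≤ p) {g : EuclideanSpace ℝ (Fin d) → F} (hg : MemLpLoc p g) :
    ∀ᵐ x, ∀ ε : ℝ≥0∞, 0 < ε → ∃ δ : ℝ, 0 < δ ∧ ∀ s, 0 < s → s ≤ δ →
      ∫⁻ z in Metric.closedBall 0 s, ‖g (x + z) - g x‖ₑ ^ p ≤ ε * ENNReal.ofReal (s ^ d) := by
  filter_upwards [hg.ae_tendsto_lintegral_enorm_sub_rpow_div hp] with x hx ε hε
  set B := volume (Metric.closedBall (0 : EuclideanSpace ℝ (Fin d)) 1) with hB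
  have hBt : B ≠ ⊤ := measure_closedBall_lt_top.ne
  obtain ⟨δ, hδ, hδs⟩ := mem_nhdsGT_iff_exists_Ioc_subset.1
    ((ENNReal.tendsto_nhds_zero.1 hx) (ε / B) (ENNReal.div_pos hε.ne' hBt))
  refine ⟨δ, hδ, fun s hs hsδ => ?_⟩
  have h := hδs ⟨hs, hsδ⟩
  have hv0 : volume (Metric.closedBall x s) ≠ 0 := (Metric.measure_closedBall_pos _ _ hs).ne'
  have hvt : volume (Metric.closedBall x s) ≠ ⊤ := measure_closedBall_lt_top.ne
  simp only [mem_ofPred_eq] at h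
  rw [ENNReal.div_le_iff hv0 hvt, Measure.addHaar_closedBall' _ _ hs.le] at h
  have hpre : Metric.closedBall (0 : EuclideanSpace ℝ (Fin d)) s =
      (fun z => x + z) ⁻¹' Metric.closedBall x s := by
    ext z
    simp
  rw [hpre, (measurePreserving_add_left volume x).setLIntegral_comp_preimage_emb
    (measurableEmbedding_addLeft x) (fun y => ‖g y - g x‖ₑ ^ p)]
  refine h.trans ?_
  rw [finrank_euclideanSpace_fin, mul_comm (ENNReal.ofReal _), ← mul_assoc]
  gcongr
  rw [mul_comm]
  exact ENNReal.mul_div_le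

/-! ### Segment averages against radial mollifiers -/

theorem lintegral_Ioc_comp_mul_right {Φ : ℝ → ℝ≥0∞} (hΦ : Measurable Φ) {r : ℝ} (hr : 0 < r) :
    ENNReal.ofReal r * ∫⁻ t in Ioc (0 : ℝ) 1, Φ (t * r) = ∫⁻ s in Ioc 0 r, Φ s := by
  rw [← lintegral_indicator measurableSet_Ioc, ← lintegral_indicator measurableSet_Ioc]
  conv_rhs => rw [← Real.smul_map_volume_mul_right hr.ne']
  rw [lintegral_smul_measure, lintegral_map (hΦ.indicator measurableSet_Ioc) (by fun_prop),
    abs_of_pos hr, smul_eq_mul]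
  congr 2
  ext t
  have h1 : 0 < t * r ↔ 0 < t := mul_pos_iff_of_pos_right hr
  have h2 : t * r ≤ r ↔ t ≤ 1 := mul_le_iff_le_one_left hr
  simp [indicator, mem_Ioc, h1, h2]

section Polar

variable {d : ℕ}

theorem nontrivial_euclideanSpace_fin (hd : 1 ≤ d) : Nontrivial (EuclideanSpace ℝ (Fin d)) := by
  have : Nonempty (Fin d) := ⟨⟨0, hd⟩⟩
  infer_instance

theorem measurable_lintegral_sphere {w : EuclideanSpace ℝ (Fin d) → ℝ≥0∞} (hw : Measurable w) :
    Measurable fun r : ℝ => ∫⁻ σ : Metric.sphere (0 : EuclideanSpace ℝ (Fin d)) 1,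
      w (r • (σ : EuclideanSpace ℝ (Fin d))) ∂(volume : Measure _).toSphere := by
  apply Measurable.lintegral_prod_right' (f := fun q : ℝ × Metric.sphere
    (0 : EuclideanSpace ℝ (Fin d)) 1 => w (q.1 • (q.2 : EuclideanSpace ℝ (Fin d))))
  apply hw.comp
  fun_prop

theorem lintegral_mul_norm_eq_polar (hd : 1 ≤ d) {w : EuclideanSpace ℝ (Fin d) → ℝ≥0∞}
    (hw : Measurable w) {ρ : ℝ → ℝ≥0∞} (hρ : Measurable ρ) :
    ∫⁻ h, w h * ρ ‖h‖ = ∫⁻ r in Ioi (0 : ℝ), ENNReal.ofReal (r ^ (d - 1)) * ρ r *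
      ∫⁻ σ : Metric.sphere (0 : EuclideanSpace ℝ (Fin d)) 1,
        w (r • (σ : EuclideanSpace ℝ (Fin d))) ∂(volume : Measure _).toSphere := by
  have := nontrivial_euclideanSpace_fin hd
  rw [lintegral_polar volume (by fun_prop), finrank_euclideanSpace_fin]
  refine setLIntegral_congr_fun measurableSet_Ioi fun r (hr : 0 < r) => ?_
  have hnorm : ∀ σ : Metric.sphere (0 : EuclideanSpace ℝ (Fin d)) 1,
      ‖r • (σ : EuclideanSpace ℝ (Fin d))‖ = r := fun σ => by
    simp [norm_smul, abs_of_pos hr]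
  simp only [hnorm]
  rw [lintegral_mul_const _ (by apply hw.comp; fun_prop), mul_assoc, mul_comm (ρ r)]

theorem lintegral_closedBall_eq_polar (hd : 1 ≤ d) {w : EuclideanSpace ℝ (Fin d) → ℝ≥0∞}
    (hw : Measurable w) (s : ℝ) :
    ∫⁻ h in Metric.closedBall 0 s, w h = ∫⁻ r in Ioc (0 : ℝ) s, ENNReal.ofReal (r ^ (d - 1)) *
      ∫⁻ σ : Metric.sphere (0 : EuclideanSpace ℝ (Fin d)) 1,
        w (r • (σ : EuclideanSpace ℝ (Fin d))) ∂(volume : Measure _).toSphere := by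
  rw [← lintegral_indicator Metric.isClosed_closedBall.measurableSet]
  have h := lintegral_mul_norm_eq_polar hd hw (ρ := (Iic s).indicator 1)
    (measurable_one.indicator measurableSet_Iic)
  have e : ∀ x, (Metric.closedBall 0 s).indicator w x = w x * (Iic s).indicator 1 ‖x‖ := fun x => by
    simp [indicator]
  simp_rw [e, h]
  rw [← Ioi_inter_Iic, inter_comm, ← setLIntegral_indicator measurableSet_Iic]
  refine lintegral_congr fun r => ?_
  by_cases hr : r ∈ Iic s <;> simp [indicator, hr]

/-- Averages of `w` along segments issued from the origin, weighted by a radial density. -/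
theorem lintegral_segment_mul_norm_eq_polar (hd : 1 ≤ d) {w : EuclideanSpace ℝ (Fin d) → ℝ≥0∞}
    (hw : Measurable w) {ρ : ℝ → ℝ≥0∞} (hρ : Measurable ρ) :
    ∫⁻ h, (∫⁻ t in Ioc (0 : ℝ) 1, w (t • h)) * ρ ‖h‖ =
      ∫⁻ r in Ioi (0 : ℝ), ENNReal.ofReal (r ^ (d - 1)) * ρ r * ∫⁻ t in Ioc (0 : ℝ) 1,
        ∫⁻ σ : Metric.sphere (0 : EuclideanSpace ℝ (Fin d)) 1,
          w ((t * r) • (σ : EuclideanSpace ℝ (Fin d))) ∂(volume : Measure _).toSphere := by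
  have hm : Measurable fun h => ∫⁻ t in Ioc (0 : ℝ) 1, w (t • h) := by
    apply Measurable.lintegral_prod_right'
      (f := fun q : EuclideanSpace ℝ (Fin d) × ℝ => w (q.2 • q.1))
    apply hw.comp
    fun_prop
  rw [lintegral_mul_norm_eq_polar hd hm hρ]
  refine lintegral_congr fun r => ?_
  rw [lintegral_lintegral_swap]
  · simp_rw [smul_smul]
  · apply Measurable.aemeasurable
    apply hw.comp
    fun_prop

/-- In polar coordinates the ball bound is the hypothesis of the dyadic lemma; the substitution `s =
t * r` turns the average over `t` into an integral over `(0, r]` divided by `r`. -/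
theorem lintegral_segment_sphere_le (hd : 1 ≤ d) {w : EuclideanSpace ℝ (Fin d) → ℝ≥0∞}
    (hw : Measurable w) {K : ℝ≥0∞} {R : ℝ}
    (h : ∀ s, 0 < s → s ≤ R →
      ∫⁻ z in Metric.closedBall 0 s, w z ≤ K * ENNReal.ofReal (s ^ d))
    {r : ℝ} (hr : 0 < r) (hrR : r ≤ R) :
    ∫⁻ t in Ioc (0 : ℝ) 1, ∫⁻ σ : Metric.sphere (0 : EuclideanSpace ℝ (Fin d)) 1,
      w ((t * r) • (σ : EuclideanSpace ℝ (Fin d))) ∂(volume : Measure _).toSphere ≤ 2 ^ d * K := by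
  have h1 := lintegral_Ioc_le_of_forall_lintegral_mul_pow_le hd (R := R) (K := K)
    (fun s hs hsR => by
      rw [← lintegral_closedBall_eq_polar hd hw]
      exact h s hs hsR) hr hrR
  rw [← lintegral_Ioc_comp_mul_right (measurable_lintegral_sphere hw) hr, mul_comm] at h1
  exact (ENNReal.mul_le_mul_iff_left (by simpa using hr) ENNReal.ofReal_ne_top).1 h1

/-- Below a small radius `δ` the segment averages are small and the density has mass at most one.
Between `δ` and `1` they are bounded and the tail mass vanishes; beyond `1` the density is zero. -/
theorem tendsto_lintegral_segment_mul_norm (hd : 1 ≤ d) {w : EuclideanSpace ℝ (Fin d) → ℝ≥0∞}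
    (hw : Measurable w) (hw1 : ∫⁻ z in Metric.closedBall 0 1, w z < ⊤)
    (hw0 : ∀ ε : ℝ≥0∞, 0 < ε → ∃ δ : ℝ, 0 < δ ∧ ∀ s, 0 < s → s ≤ δ →
      ∫⁻ z in Metric.closedBall 0 s, w z ≤ ε * ENNReal.ofReal (s ^ d))
    {ρ : ℕ → ℝ → ℝ≥0∞} (hρ : ∀ n, Measurable (ρ n))
    (hρ1 : ∀ n, ∫⁻ r in Ioi (0 : ℝ), ENNReal.ofReal (r ^ (d - 1)) * ρ n r = 1)
    (htail : ∀ δ : ℝ, 0 < δ →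
      Tendsto (fun n => ∫⁻ r in Ioi δ, ENNReal.ofReal (r ^ (d - 1)) * ρ n r) atTop (𝓝 0))
    (hsupp : ∀ n, ∀ᵐ r : ℝ, 1 < r → ρ n r = 0) :
    Tendsto (fun n => ∫⁻ h, (∫⁻ t in Ioc (0 : ℝ) 1, w (t • h)) * ρ n ‖h‖) atTop (𝓝 0) := by
  rw [ENNReal.tendsto_nhds_zero]
  intro ε hε
  rcases eq_or_ne ε ⊤ with rfl | hεt
  · exact Eventually.of_forall fun _ => le_top
  -- The factor `2 ^ d` compensates the loss in `lintegral_segment_sphere_le`.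
  set ε' : ℝ≥0∞ := ε / 2 / 2 ^ d with hε'
  have h2d : (2 : ℝ≥0∞) ^ d ≠ ⊤ := by simp
  have hε'0 : 0 < ε' := ENNReal.div_pos (ENNReal.half_pos hε.ne').ne' h2d
  have hε't : ε' ≠ ⊤ := ENNReal.div_ne_top (ENNReal.div_ne_top hεt (by simp)) (by simp)
  obtain ⟨δ, hδ0, hδ⟩ := hw0 ε' hε'0
  set M := ∫⁻ z in Metric.closedBall 0 1, w z with hM
  -- The first term handles `s ≤ δ`; the second handles `δ ≤ s ≤ 1`, where the integral is at most
  -- `M` and `s ^ d ≥ δ ^ d`.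
  set K : ℝ≥0∞ := ε' + M / ENNReal.ofReal (δ ^ d) with hK
  have hδd : ENNReal.ofReal (δ ^ d) ≠ 0 := by simpa using pow_pos hδ0 d
  have hKt : K ≠ ⊤ := ENNReal.add_ne_top.2 ⟨hε't, ENNReal.div_ne_top hw1.ne hδd⟩
  have hKle : ∀ s, 0 < s → s ≤ 1 →
      ∫⁻ z in Metric.closedBall 0 s, w z ≤ K * ENNReal.ofReal (s ^ d) := by
    intro s hs hs1
    rcases le_total s δ with hsδ | hsδ
    · refine (hδ s hs hsδ).trans ?_
      gcongr
      exact le_self_add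
    · calc ∫⁻ z in Metric.closedBall 0 s, w z ≤ M :=
            lintegral_mono_set (Metric.closedBall_subset_closedBall hs1)
        _ ≤ M / ENNReal.ofReal (δ ^ d) * ENNReal.ofReal (δ ^ d) :=
            (ENNReal.div_mul_cancel hδd ENNReal.ofReal_ne_top).ge
        _ ≤ K * ENNReal.ofReal (s ^ d) := by
            gcongr
            exact le_add_self
  have htail' : ∀ᶠ n in atTop,
      (2 ^ d * K) * ∫⁻ r in Ioi δ, ENNReal.ofReal (r ^ (d - 1)) * ρ n r ≤ ε / 2 := by
    have := ENNReal.Tendsto.const_mul (htail δ hδ0) (a := 2 ^ d * K)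
      (Or.inr (ENNReal.mul_ne_top h2d hKt))
    rw [mul_zero] at this
    exact (ENNReal.tendsto_nhds_zero.1 this) _ (ENNReal.half_pos hε.ne')
  filter_upwards [htail'] with n hn
  rw [lintegral_segment_mul_norm_eq_polar hd hw (hρ n), ← Ioc_union_Ioi_eq_Ioi hδ0.le]
  refine (lintegral_union_le _ _ _).trans ?_
  rw [← ENNReal.add_halves ε]
  refine add_le_add ?_ (le_trans ?_ hn)
  · calc _ ≤ ∫⁻ r in Ioc 0 δ, ENNReal.ofReal (r ^ (d - 1)) * ρ n r * (ε / 2) := by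
          refine setLIntegral_mono' measurableSet_Ioc fun r hr => ?_
          gcongr
          refine (lintegral_segment_sphere_le hd hw hδ hr.1 hr.2).trans ?_
          exact ENNReal.mul_div_le
      _ ≤ ∫⁻ r in Ioi 0, ENNReal.ofReal (r ^ (d - 1)) * ρ n r * (ε / 2) :=
          lintegral_mono_set Ioc_subset_Ioi_self
      _ = ε / 2 := by
          rw [lintegral_mul_const' _ _ (ENNReal.div_ne_top hεt (by simp)), hρ1, one_mul]
  · rw [← lintegral_const_mul' _ _ (ENNReal.mul_ne_top h2d hKt)]
    refine lintegral_mono_ae ?_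
    filter_upwards [ae_restrict_of_ae (hsupp n), ae_restrict_mem measurableSet_Ioi] with r hr hrδ
    rw [mul_comm]
    rcases le_or_gt r 1 with hr1 | hr1
    · gcongr
      exact lintegral_segment_sphere_le hd hw hKle (hδ0.trans hrδ) hr1
    · simp [hr hr1]

end Polar

/-! ### Perturbation in `L^p` and measurable mollifiers -/

/-- Perturbing a function by a term that is small in `L^p` does not change the limit of its
`L^p` norms. -/
theorem tendsto_lintegral_rpow_of_tendsto_zero {α : Type*} [MeasurableSpace α]
    {ν : ℕ → Measure α} {p : ℝ} (hp : 1 ≤ p) {a b c : α → ℝ≥0∞} (ha : Measurable a)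
    (hb : Measurable b) (hc : Measurable c) (hab : ∀ z, a z ≤ b z + c z)
    (hba : ∀ z, b z ≤ a z + c z) {B : ℝ≥0∞} (hBt : B ≠ ⊤)
    (hB : ∀ n, ∫⁻ z, b z ^ p ∂(ν n) = B)
    (hC : Tendsto (fun n => ∫⁻ z, c z ^ p ∂(ν n)) atTop (𝓝 0)) :
    Tendsto (fun n => ∫⁻ z, a z ^ p ∂(ν n)) atTop (𝓝 B) := by
  have hp0 : 0 < p := by linarith
  have hmink : ∀ {f g k : α → ℝ≥0∞}, Measurable g → Measurable k → (∀ z, f z ≤ g z + k z) →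
      ∀ n, (∫⁻ z, f z ^ p ∂(ν n)) ^ (1 / p) ≤
        (∫⁻ z, g z ^ p ∂(ν n)) ^ (1 / p) + (∫⁻ z, k z ^ p ∂(ν n)) ^ (1 / p) := by
    intro f g k hg hk h n
    refine le_trans ?_ (ENNReal.lintegral_Lp_add_le hg.aemeasurable hk.aemeasurable hp)
    gcongr with z
    exact h z
  have hC' : Tendsto (fun n => (∫⁻ z, c z ^ p ∂(ν n)) ^ (1 / p)) atTop (𝓝 0) := by
    have := (ENNReal.continuous_rpow_const (y := 1 / p)).tendsto 0 |>.comp hC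
    rwa [ENNReal.zero_rpow_of_pos (by positivity)] at this
  have hBt' : B ^ (1 / p) ≠ ⊤ := ENNReal.rpow_ne_top_of_nonneg (by positivity) hBt
  -- Minkowski in both directions traps the norm of `a`. Truncated subtraction allows that norm to
  -- be infinite for some `n`; finiteness of `B` makes the lower bound converge.
  have key : Tendsto (fun n => (∫⁻ z, a z ^ p ∂(ν n)) ^ (1 / p)) atTop (𝓝 (B ^ (1 / p))) := by
    refine tendsto_of_tendsto_of_tendsto_of_le_of_le
      (g := fun n => B ^ (1 / p) - (∫⁻ z, c z ^ p ∂(ν n)) ^ (1 / p))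
      (h := fun n => B ^ (1 / p) + (∫⁻ z, c z ^ p ∂(ν n)) ^ (1 / p)) ?_ ?_ ?_ ?_
    · simpa using ENNReal.Tendsto.sub (tendsto_const_nhds (x := B ^ (1 / p))) hC' (Or.inl hBt')
    · simpa using (tendsto_const_nhds (x := B ^ (1 / p))).add hC'
    · intro n
      rw [tsub_le_iff_right, ← hB n]
      exact hmink ha hc hba n
    · intro n
      simp only [← hB n]
      exact hmink hb hc hab n
  have := (ENNReal.continuous_rpow_const (y := p)).tendsto _ |>.comp key
  simpa [Function.comp_def, ← ENNReal.rpow_mul, inv_mul_cancel₀ hp0.ne'] using this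

theorem IsRadialMollifier.exists_measurable {d : ℕ} {ρ : ℕ → ℝ → ℝ} (hρ : IsRadialMollifier d ρ) :
    ∃ ρ' : ℕ → ℝ → ℝ≥0∞, (∀ n, Measurable (ρ' n)) ∧
      (∀ n, ∀ᵐ r : ℝ, 0 < r → ENNReal.ofReal (ρ n r) = ρ' n r) ∧
      (∀ n, ∫⁻ r in Ioi (0 : ℝ), ENNReal.ofReal (r ^ (d - 1)) * ρ' n r = 1) ∧
      (∀ δ : ℝ, 0 < δ →
        Tendsto (fun n => ∫⁻ r in Ioi δ, ENNReal.ofReal (r ^ (d - 1)) * ρ' n r) atTop (𝓝 0)) ∧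
      (∀ n, ∀ᵐ r : ℝ, 1 < r → ρ' n r = 0) := by
  have hm : ∀ n, AEStronglyMeasurable (ρ n) (volume.restrict (Ioi 0)) := fun n =>
    (hρ.locallyIntegrable n).aestronglyMeasurable
  have heq : ∀ n, ∀ᵐ r : ℝ, 0 < r → ENNReal.ofReal (ρ n r) = ENNReal.ofReal ((hm n).mk _ r) :=
    fun n => by
      filter_upwards [(ae_restrict_iff' measurableSet_Ioi).1 (hm n).ae_eq_mk] with r hr hr0
      rw [hr hr0]
  -- A non-integrable function has Bochner integral `0`, which the normalization to `1` excludes.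
  have hint : ∀ n, IntegrableOn (fun r => ρ n r * r ^ (d - 1)) (Ioi 0) := fun n => by
    by_contra h
    have := hρ.integral_eq_one n
    rw [integral_undef h] at this
    exact zero_ne_one this
  have hlint : ∀ n (δ : ℝ), 0 ≤ δ →
      ∫⁻ r in Ioi δ, ENNReal.ofReal (r ^ (d - 1)) * ENNReal.ofReal ((hm n).mk _ r) =
        ENNReal.ofReal (∫ r in Ioi δ, ρ n r * r ^ (d - 1)) := by
    intro n δ hδ
    rw [ofReal_integral_eq_lintegral_ofReal ((hint n).mono_set (Ioi_subset_Ioi hδ))]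
    · refine lintegral_congr_ae ?_
      filter_upwards [ae_restrict_of_ae (heq n), ae_restrict_mem measurableSet_Ioi] with r hr hr0
      have hr0' : 0 < r := hδ.trans_lt hr0
      rw [← hr hr0', ← ENNReal.ofReal_mul (by positivity), mul_comm]
    · filter_upwards [ae_restrict_of_ae (hρ.nonneg n), ae_restrict_mem measurableSet_Ioi]
        with r hr hr0
      have hr0' : 0 < r := hδ.trans_lt hr0
      exact mul_nonneg (hr hr0') (by positivity)
  refine ⟨fun n r => ENNReal.ofReal ((hm n).mk _ r), fun n =>
    (hm n).stronglyMeasurable_mk.measurable.ennreal_ofReal, heq, fun n => ?_, fun δ hδ => ?_,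
    fun n => ?_⟩
  · rw [hlint n 0 le_rfl, hρ.integral_eq_one n, ENNReal.ofReal_one]
  · simp_rw [hlint _ δ hδ.le]
    simpa using ENNReal.tendsto_ofReal (hρ.tendsto_tail δ hδ)
  · filter_upwards [heq n, hρ.eq_zero_of_one_lt n] with r hr hr1 h1
    rw [← hr (by linarith), hr1 h1, ENNReal.ofReal_zero]

/-! ### The spherical constant -/

section Gamma

variable {d : ℕ}

theorem measurable_enorm_div_rpow {q : EuclideanSpace ℝ (Fin d) → ℝ} (hq : Measurable q) (p : ℝ) :
    Measurable fun h => (‖q h‖ₑ / ‖h‖ₑ) ^ p := by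
  fun_prop

theorem enorm_inner_smul_div_rpow (V : EuclideanSpace ℝ (Fin d)) (p : ℝ) {r : ℝ} (hr : 0 < r)
    (σ : Metric.sphere (0 : EuclideanSpace ℝ (Fin d)) 1) :
    (‖(inner ℝ V (r • (σ : EuclideanSpace ℝ (Fin d))) : ℝ)‖ₑ /
      ‖r • (σ : EuclideanSpace ℝ (Fin d))‖ₑ) ^ p =
      ‖(inner ℝ V (σ : EuclideanSpace ℝ (Fin d)) : ℝ)‖ₑ ^ p := by
  have hσ : ‖(σ : EuclideanSpace ℝ (Fin d))‖ₑ = 1 := by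
    rw [← ofReal_norm, norm_eq_of_mem_sphere, ENNReal.ofReal_one]
  rw [inner_smul_right, enorm_smul, enorm_mul, hσ, mul_one,
    ENNReal.mul_div_right_comm, ENNReal.div_self (by simpa using hr.ne') enorm_ne_top, one_mul]

theorem lintegral_enorm_inner_div_mul_norm (hd : 1 ≤ d) (V : EuclideanSpace ℝ (Fin d)) (p : ℝ)
    {ρ : ℝ → ℝ≥0∞} (hρ : Measurable ρ) :
    ∫⁻ h, (‖(inner ℝ V h : ℝ)‖ₑ / ‖h‖ₑ) ^ p * ρ ‖h‖ =
      (∫⁻ r in Ioi (0 : ℝ), ENNReal.ofReal (r ^ (d - 1)) * ρ r) *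
        ∫⁻ σ : Metric.sphere (0 : EuclideanSpace ℝ (Fin d)) 1,
          ‖(inner ℝ V (σ : EuclideanSpace ℝ (Fin d)) : ℝ)‖ₑ ^ p ∂(volume : Measure _).toSphere := by
  rw [lintegral_mul_norm_eq_polar hd (measurable_enorm_div_rpow (by fun_prop) p) hρ,
    ← lintegral_mul_const _ (by fun_prop)]
  refine setLIntegral_congr_fun measurableSet_Ioi fun r hr => ?_
  simp only [enorm_inner_smul_div_rpow V p hr]

/-- Lebesgue measure is invariant under the reflection exchanging `v` and `w`. Polar coordinates
transfer this to the sphere, after cancelling a radial factor that is nonzero and finite. -/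
theorem lintegral_sphere_enorm_inner_eq_of_norm_eq (hd : 1 ≤ d)
    {v w : EuclideanSpace ℝ (Fin d)} (hvw : ‖v‖ = ‖w‖) (p : ℝ) :
    ∫⁻ σ : Metric.sphere (0 : EuclideanSpace ℝ (Fin d)) 1,
        ‖(inner ℝ v (σ : EuclideanSpace ℝ (Fin d)) : ℝ)‖ₑ ^ p ∂(volume : Measure _).toSphere =
      ∫⁻ σ : Metric.sphere (0 : EuclideanSpace ℝ (Fin d)) 1,
        ‖(inner ℝ w (σ : EuclideanSpace ℝ (Fin d)) : ℝ)‖ₑ ^ p ∂(volume : Measure _).toSphere := by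
  -- An auxiliary profile with radial mass `1 / d`; only `0 < c < ⊤` matters.
  set ρ : ℝ → ℝ≥0∞ := (Ioc 0 1).indicator 1 with hρdef
  have hρ : Measurable ρ := measurable_one.indicator measurableSet_Ioc
  set c := ∫⁻ r in Ioi (0 : ℝ), ENNReal.ofReal (r ^ (d - 1)) * ρ r with hc
  have hc' : c = ENNReal.ofReal (1 / d) := by
    have e1 : c = ∫⁻ r in Ioc (0 : ℝ) 1, ENNReal.ofReal (r ^ (d - 1)) := by
      have hsub : Ioc (0 : ℝ) 1 ∩ Ioi 0 = Ioc 0 1 :=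
        inter_eq_self_of_subset_left Ioc_subset_Ioi_self
      rw [← hsub, ← setLIntegral_indicator measurableSet_Ioc]
      refine lintegral_congr fun r => ?_
      by_cases hr : r ∈ Ioc (0 : ℝ) 1 <;> simp [hρdef, hr]
    rw [e1, ← ofReal_integral_eq_lintegral_ofReal (intervalIntegral.intervalIntegrable_pow _).1,
      ← intervalIntegral.integral_of_le zero_le_one, integral_pow]
    · congr 1
      have hd0 : d ≠ 0 := by omega
      simp [Nat.cast_sub hd, Nat.sub_add_cancel hd, zero_pow hd0]
    · filter_upwards [ae_restrict_mem measurableSet_Ioc] with r hr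
      exact pow_nonneg hr.1.le _
  have hd' : (0 : ℝ) < d := by exact_mod_cast hd
  have hc0 : c ≠ 0 := by
    rw [hc', ENNReal.ofReal_ne_zero_iff]
    positivity
  have hct : c ≠ ⊤ := by simp [hc']
  have hL : (Submodule.span ℝ {v - w})ᗮ.reflection v = w := Submodule.reflection_sub hvw
  set L := (Submodule.span ℝ {v - w})ᗮ.reflection
  have h1 := lintegral_enorm_inner_div_mul_norm hd v p hρ
  have h2 := lintegral_enorm_inner_div_mul_norm hd w p hρ
  have h3 : ∫⁻ h, (‖(inner ℝ v h : ℝ)‖ₑ / ‖h‖ₑ) ^ p * ρ ‖h‖ =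
      ∫⁻ h, (‖(inner ℝ w h : ℝ)‖ₑ / ‖h‖ₑ) ^ p * ρ ‖h‖ := by
    rw [← L.measurePreserving.lintegral_comp (f := fun h =>
      (‖(inner ℝ w h : ℝ)‖ₑ / ‖h‖ₑ) ^ p * ρ ‖h‖) (by fun_prop)]
    refine lintegral_congr fun h => ?_
    rw [← hL, L.inner_map_map, L.norm_map, ← ofReal_norm (L h), L.norm_map, ofReal_norm]
  rw [h1, h2] at h3
  exact (ENNReal.mul_right_inj hc0 hct).1 h3

theorem lintegral_sphere_enorm_inner_eq (hd : 1 ≤ d) {p : ℝ} (hp : 0 < p)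
    (V : EuclideanSpace ℝ (Fin d)) (e : Metric.sphere (0 : EuclideanSpace ℝ (Fin d)) 1) :
    ∫⁻ σ : Metric.sphere (0 : EuclideanSpace ℝ (Fin d)) 1,
        ‖(inner ℝ V (σ : EuclideanSpace ℝ (Fin d)) : ℝ)‖ₑ ^ p ∂(volume : Measure _).toSphere =
      ENNReal.ofReal (sphereGamma p e * ‖V‖ ^ p) := by
  have hV : ‖V‖ = ‖‖V‖ • (e : EuclideanSpace ℝ (Fin d))‖ := by
    simp [norm_smul]
  have hcont : Continuous fun σ : Metric.sphere (0 : EuclideanSpace ℝ (Fin d)) 1 =>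
      |(inner ℝ (σ : EuclideanSpace ℝ (Fin d)) (e : EuclideanSpace ℝ (Fin d)) : ℝ)| ^ p :=
    Continuous.rpow_const (by fun_prop) fun _ => Or.inr hp.le
  have hint := hcont.integrable_of_hasCompactSupport
    (μ := (volume : Measure (EuclideanSpace ℝ (Fin d))).toSphere) (HasCompactSupport.of_compactSpace _)
  rw [lintegral_sphere_enorm_inner_eq_of_norm_eq hd hV, mul_comm,
    ENNReal.ofReal_mul (by positivity), sphereGamma, ofReal_integral_eq_lintegral_ofReal hint
      (ae_of_all _ fun σ => by positivity), ← lintegral_const_mul' _ _ ENNReal.ofReal_ne_top]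
  refine lintegral_congr fun σ => ?_
  rw [← ENNReal.ofReal_mul (by positivity), ← Real.mul_rpow (norm_nonneg _) (abs_nonneg _),
    ← ofReal_norm, ENNReal.ofReal_rpow_of_nonneg (norm_nonneg _) hp.le, real_inner_smul_left,
    norm_mul, norm_norm, real_inner_comm, Real.norm_eq_abs]

theorem lintegral_ofReal_rpow_div_mul_eq (hd : 1 ≤ d) {p : ℝ} (hp : 0 ≤ p)
    (q : EuclideanSpace ℝ (Fin d) → ℝ) {ρ : ℝ → ℝ} {ρ' : ℝ → ℝ≥0∞}
    (h : ∀ᵐ r : ℝ, 0 < r → ENNReal.ofReal (ρ r) = ρ' r) :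
    ∫⁻ h, ENNReal.ofReal (|q h| ^ p / ‖h‖ ^ p * ρ ‖h‖) =
      ∫⁻ h, (‖q h‖ₑ / ‖h‖ₑ) ^ p * ρ' ‖h‖ := by
  have := nontrivial_euclideanSpace_fin hd
  refine lintegral_congr_ae ?_
  filter_upwards [ae_norm_of_ae volume h, measure_eq_zero_iff_ae_notMem.1
    (measure_singleton (0 : EuclideanSpace ℝ (Fin d)))] with z hz hz0
  have hn : 0 < ‖z‖ := norm_pos_iff.2 hz0
  rw [ENNReal.ofReal_mul (by positivity), hz, ENNReal.ofReal_div_of_pos (by positivity),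
    ENNReal.div_rpow_of_nonneg _ _ hp, ← ENNReal.ofReal_rpow_of_nonneg (abs_nonneg _) hp,
    ← ENNReal.ofReal_rpow_of_nonneg (norm_nonneg _) hp, ofReal_norm, ← Real.norm_eq_abs,
    ofReal_norm]

end Gamma

/-! ### The two limits -/

section Main

variable {d : ℕ} {p : ℝ} {u v : EuclideanSpace ℝ (Fin d) → ℝ}
  {g : EuclideanSpace ℝ (Fin d) → EuclideanSpace ℝ (Fin d)}

theorem ae_comp_add_eq (h : u =ᵐ[volume] v) (x : EuclideanSpace ℝ (Fin d)) :
    ∀ᵐ z, u (x + z) = v (x + z) :=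
  (measurePreserving_add_left volume x).quasiMeasurePreserving.ae h

theorem taylorRemainder_congr (h : u =ᵐ[volume] v) {x : EuclideanSpace ℝ (Fin d)}
    (hx : u x = v x) (ρ : ℝ → ℝ) (V : EuclideanSpace ℝ (Fin d)) :
    taylorRemainder ρ p u V x = taylorRemainder ρ p v V x := by
  refine lintegral_congr_ae ?_
  filter_upwards [ae_comp_add_eq h x] with z hz
  rw [hz, hx]

theorem nonlocalD_congr (h : u =ᵐ[volume] v) {x : EuclideanSpace ℝ (Fin d)}
    (hx : u x = v x) (ρ : ℝ → ℝ) : nonlocalD ρ p u x = nonlocalD ρ p v x := by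
  refine lintegral_congr_ae ?_
  filter_upwards [h] with y hy
  rw [hy, hx]

theorem nonlocalD_eq_lintegral_add (ρ : ℝ → ℝ) (x : EuclideanSpace ℝ (Fin d)) :
    nonlocalD ρ p u x =
      ∫⁻ h, ENNReal.ofReal (|u (x + h) - u x| ^ p / ‖h‖ ^ p * ρ ‖h‖) := by
  rw [nonlocalD, ← lintegral_add_left_eq_self _ x]
  refine lintegral_congr fun h => ?_
  rw [sub_add_cancel_left, norm_neg, abs_sub_comm]

theorem MemLpLoc.congr {F : Type*} [NormedAddCommGroup F]
    {f f' : EuclideanSpace ℝ (Fin d) → F} (hf : MemLpLoc p f) (h : f =ᵐ[volume] f') :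
    MemLpLoc p f' := fun K hK => (hf K hK).ae_eq (ae_restrict_of_ae h)

theorem ae_tendsto_taylorRemainder (hd : 1 ≤ d) (hp : 1 ≤ p) {ρ : ℕ → ℝ → ℝ}
    (hρ : IsRadialMollifier d ρ) (hum : Measurable u) (hgm : Measurable g)
    (hg : HasWeakGradient u g) (hgp : MemLpLoc p g) :
    ∀ᵐ x, Tendsto (fun n => taylorRemainder (ρ n) p u (g x) x) atTop (𝓝 0) := by
  have := nontrivial_euclideanSpace_fin hd
  have hp0 : 0 ≤ p := by linarith
  obtain ⟨ρ', hρm, hρeq, hρ1, htail, hsupp⟩ := hρ.exists_measurable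
  filter_upwards [hg.ae_ae_enorm_remainder_le hum hgm, hgp.ae_forall_exists_lintegral_le hp]
    with x hx hleb
  have hw : Measurable fun z => ‖g (x + z) - g x‖ₑ ^ p := by fun_prop
  have hw1 : ∫⁻ z in Metric.closedBall 0 1, ‖g (x + z) - g x‖ₑ ^ p < ⊤ := by
    have hpre : Metric.closedBall (0 : EuclideanSpace ℝ (Fin d)) 1 =
        (fun z => x + z) ⁻¹' Metric.closedBall x 1 := by
      ext z
      simp
    rw [hpre, (measurePreserving_add_left volume x).setLIntegral_comp_preimage_emb
      (measurableEmbedding_addLeft x) (fun y => ‖g y - g x‖ₑ ^ p)]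
    exact hgp.lintegral_enorm_sub_rpow_lt_top hp _ (isCompact_closedBall _ _)
  refine tendsto_of_tendsto_of_tendsto_of_le_of_le tendsto_const_nhds
    (tendsto_lintegral_segment_mul_norm hd hw hw1 hleb hρm hρ1 htail hsupp)
    (fun _ => zero_le) fun n => ?_
  rw [taylorRemainder, lintegral_ofReal_rpow_div_mul_eq hd hp0 _ (hρeq n)]
  refine lintegral_mono_ae ?_
  filter_upwards [hx, measure_eq_zero_iff_ae_notMem.1
    (measure_singleton (0 : EuclideanSpace ℝ (Fin d)))] with h hh hh0
  gcongr
  refine le_trans ?_ (rpow_lintegral_Ioc_le (by fun_prop) hp)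
  gcongr
  rw [ENNReal.div_le_iff (by simpa using hh0) enorm_ne_top, mul_comm]
  exact hh

theorem tendsto_nonlocalD_of_tendsto_taylorRemainder (hd : 1 ≤ d) (hp : 1 ≤ p) {ρ : ℕ → ℝ → ℝ}
    (hρ : IsRadialMollifier d ρ) (hum : Measurable u) {V x : EuclideanSpace ℝ (Fin d)}
    (hT : Tendsto (fun n => taylorRemainder (ρ n) p u V x) atTop (𝓝 0))
    (e : Metric.sphere (0 : EuclideanSpace ℝ (Fin d)) 1) :
    Tendsto (fun n => nonlocalD (ρ n) p u x) atTop
      (𝓝 (ENNReal.ofReal (sphereGamma p e * ‖V‖ ^ p))) := by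
  have hp0 : 0 < p := by linarith
  obtain ⟨ρ', hρm, hρeq, hρ1, -, -⟩ := hρ.exists_measurable
  have hdens : ∀ {q : EuclideanSpace ℝ (Fin d) → ℝ}, Measurable q → ∀ n,
      ∫⁻ h, (‖q h‖ₑ / ‖h‖ₑ) ^ p * ρ' n ‖h‖ =
        ∫⁻ h, (‖q h‖ₑ / ‖h‖ₑ) ^ p ∂(volume.withDensity fun h => ρ' n ‖h‖) := by
    intro q hq n
    rw [lintegral_withDensity_eq_lintegral_mul _ (f := fun h => ρ' n ‖h‖) (by fun_prop)
      (measurable_enorm_div_rpow hq p)]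
    exact lintegral_congr fun h => mul_comm _ _
  have hq1 : Measurable fun h => u (x + h) - u x := by fun_prop
  have hq2 : Measurable fun h => (inner ℝ V h : ℝ) := by fun_prop
  have hq3 : Measurable fun h => u (x + h) - u x - inner ℝ V h := by fun_prop
  have hD : ∀ n, nonlocalD (ρ n) p u x = ∫⁻ h, (‖u (x + h) - u x‖ₑ / ‖h‖ₑ) ^ p
      ∂(volume.withDensity fun h => ρ' n ‖h‖) := fun n => by
    rw [nonlocalD_eq_lintegral_add, lintegral_ofReal_rpow_div_mul_eq hd hp0.le _ (hρeq n),
      hdens hq1]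
  have hR : ∀ n, taylorRemainder (ρ n) p u V x =
      ∫⁻ h, (‖u (x + h) - u x - inner ℝ V h‖ₑ / ‖h‖ₑ) ^ p
        ∂(volume.withDensity fun h => ρ' n ‖h‖) := fun n => by
    rw [taylorRemainder, lintegral_ofReal_rpow_div_mul_eq hd hp0.le _ (hρeq n), hdens hq3]
  simp_rw [hD]
  simp_rw [hR] at hT
  -- Here `a` is the difference quotient, `b` its linear part, and `c` the Taylor remainder divided
  -- by `‖h‖`.
  refine tendsto_lintegral_rpow_of_tendsto_zero (b := fun h => ‖(inner ℝ V h : ℝ)‖ₑ / ‖h‖ₑ) hp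
    (by fun_prop) (by fun_prop) (by fun_prop) (fun h => ?_) (fun h => ?_)
    ENNReal.ofReal_ne_top (fun n => ?_) hT
  · rw [← ENNReal.add_div]
    gcongr
    refine le_trans (le_of_eq ?_) (enorm_add_le _ _)
    rw [add_sub_cancel]
  · rw [← ENNReal.add_div]
    gcongr
    refine le_trans (le_of_eq ?_) enorm_sub_le
    rw [sub_sub_cancel]
  · rw [← hdens hq2, lintegral_enorm_inner_div_mul_norm hd V p (hρm n), hρ1, one_mul,
      lintegral_sphere_enorm_inner_eq hd hp0 V e]

end Main

theorem mainTheorem1 (d : ℕ) (hd : 1 ≤ d) (p : ℝ) (hp : 1 ≤ p)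
    (ρ : ℕ → ℝ → ℝ) (hρ : IsRadialMollifier d ρ)
    (u : EuclideanSpace ℝ (Fin d) → ℝ) (hu : MemSobolevLoc p u)
    (gradu : EuclideanSpace ℝ (Fin d) → EuclideanSpace ℝ (Fin d))
    (hgradu : HasWeakGradient u gradu) :
    (∀ᵐ x : EuclideanSpace ℝ (Fin d),
      Tendsto (fun n => taylorRemainder (ρ n) p u (gradu x) x) atTop (𝓝 0)) ∧
    (∀ e : Metric.sphere (0 : EuclideanSpace ℝ (Fin d)) 1,
      ∀ᵐ x : EuclideanSpace ℝ (Fin d),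
        Tendsto (fun n => nonlocalD (ρ n) p u x) atTop
          (𝓝 (ENNReal.ofReal (sphereGamma p e * ‖gradu x‖ ^ p)))) := by
  -- The `L^p` bound is known for some weak gradient `G`; uniqueness transfers it to `gradu`.
  obtain ⟨-, G, hG, hGp⟩ := hu
  have hum := hgradu.locallyIntegrable.aestronglyMeasurable
  have hgm := hgradu.locallyIntegrable_grad.aestronglyMeasurable
  have huv := hum.ae_eq_mk
  have hgg := hgm.ae_eq_mk
  have hvm := hum.stronglyMeasurable_mk.measurable
  -- The limits are proved for measurable representatives, then transferred at the points `x` where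
  -- these agree with `u` and `gradu`.
  have hT := ae_tendsto_taylorRemainder hd hp hρ hvm hgm.stronglyMeasurable_mk.measurable
    (hgradu.congr huv hgg) ((hGp.congr (hG.ae_eq hgradu)).congr hgg)
  refine ⟨?_, fun e => ?_⟩
  · filter_upwards [hT, huv, hgg] with x hx hux hgx
    simp_rw [taylorRemainder_congr huv hux, hgx]
    exact hx
  · filter_upwards [hT, huv, hgg] with x hx hux hgx
    simp_rw [nonlocalD_congr huv hux, hgx]
    exact tendsto_nonlocalD_of_tendsto_taylorRemainder hd hp hρ hvm hx e
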